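/- Let $J\ge 1$ and let $\mathcal Z=\mathcal Z_1\times\cdots\times\mathcal Z_J$ be a product of Euclidean (finite-dimensional real inner product) spaces, with the inner product $\langle x,y\rangle=\sum_{j=1}^J\langle x_j,y_j\rangle_{\mathcal Z_j}$. Let $T:\mathcal Z\to\mathcal Z$, $Tx=(T_1x,\dots,T_Jx)$, be nonexpansive, i.e. $\|Tx-Ty\|\le\|x-y\|$ for all $x,y\in\mathcal Z$, and suppose that $\mathrm{Fix}(T)=\{x\in\mathcal Z: Tx=x\}$ is nonempty. For $\vartheta\subseteq\mathcal J=\{1,\dots,J\}$ let $\hat T^{(\vartheta)}:\mathcal Z\to\mathcal Z$ be given by $\hat T^{(\vartheta)}_jx=T_jx$ if $j\in\vartheta$ and $\hat T^{(\vartheta)}_jx=x_j$ otherwise. Let $(\zeta^k)_{k\ge1}$ be an i.i.d. sequence of random subsets of $\mathcal J$ on a probability space $(\Omega,\mathcal F,\mathbb P)$ such that $$\forall j\in\mathcal J\ \ \exists\,\vartheta\subseteq\mathcal J:\quad j\in\vartheta\ \text{ and }\ \mathbb P(\zeta^1=\vartheta)>0 .$$ Let $(\alpha_k)_{k\ge1}$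 be a nondecreasing real sequence with $\alpha_1=0$ and $0\le\alpha_k\le\alpha<1$ for all $k\ge1$, let $(\rho_k)_{k\ge 1}$ be a real sequence, and let $\rho,\theta,\hat\delta>0$ be such that (i) $\hat\delta>\dfrac{\alpha^2(1+\alpha)+\alpha\theta}{1-\alpha^2}$; (ii) $0<\rho\le\rho_k<\dfrac{\hat\delta-\alpha[\alpha(1+\alpha)+\alpha\hat\delta+\theta]}{\hat\delta[1+\alpha(1+\alpha)+\alpha\hat\delta+\theta]}$ for all $k\ge1$. Let $x^0,x^1\in\mathcal Z$ be arbitrary (deterministic) points and define, for $k\ge1$, $$x^{k+1}=x^k+\alpha_k(x^k-x^{k-1})+\rho_k\bigl[\hat T^{(\zeta^{k+1})}\bigl(x^k+\alpha_k(x^k-x^{k-1})\bigr)-x^k-\alpha_k(x^k-x^{k-1})\bigr].$$ Then, almost surely, the sequence $(x^k)$ converges to some (possibly random) point of $\mathrm{Fix}(T)$. -/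

import Mathlib

noncomputable section

open Classical in
/-- The block operator of `T` for the set of blocks `ϑ`: its `j`-th component at `x` is the `j`-th
component of `T x` if `j ∈ ϑ`, and `x j` otherwise. The space `PiLp 2 Z` is the product of the
spaces `Z j` with the inner product `⟪x, y⟫ = ∑ j, ⟪x j, y j⟫`. -/
def blockOperator {J : ℕ} {Z : Fin J → Type*} (T : PiLp 2 Z → PiLp 2 Z) (ϑ : Set (Fin J))
    (x : PiLp 2 Z) : PiLp 2 Z :=
  WithLp.toLp 2 (fun j => if j ∈ ϑ then T x j else x j)

end

open MeasureTheory ProbabilityTheory Filter Topology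

/-! Write `q j` for the probability that block `j` is selected, and measure squared distances with
weights `(q j)⁻¹`. One relaxed block step from the extrapolated point `y` changes the weighted
squared distance to a fixed point `z` through a sum over the selected blocks only. Given the past,
the weights cancel the selection probabilities, so the mean of that sum is `‖T y - z‖ ^ 2 - ‖y - z‖
^ 2`, which is nonpositive by nonexpansiveness.

Inertia adds multiples of the squared increments `‖x (n + 1) - x n‖ ^ 2`. The bound on the
relaxation parameters lets a Lyapunov function absorb them (`lyapunov_step`), leaving a decrease of
`θ` times the next squared increment. In mean this gives bounded distances and summable squared
increments (`integral_bounded`). The Lyapunov function is thus an L¹-bounded supermartingale, and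
its almost sure convergence passes to the distances to `z` (`ae_exists_tendsto_weightedSq`). The
same averaging makes the mean squared residuals at `y` summable (`ae_tendsto_residual`). An Opial
argument over a countable dense set of fixed points concludes (`tendsto_fixedPoint_of_weightedSq`).
-/

/-! ### Real sequences -/

/-- A nonnegative sequence that contracts up to an error tending to zero tends to zero. -/
theorem tendsto_zero_of_le_mul_add {e ε : ℕ → ℝ} {α : ℝ} (hα0 : 0 ≤ α) (hα : α < 1)
    (he : ∀ n, 0 ≤ e n) (hε : Tendsto ε atTop (𝓝 0)) (h : ∀ n, e (n + 1) ≤ α * e n + ε n) :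
    Tendsto e atTop (𝓝 0) := by
  rw [Metric.tendsto_atTop]
  intro η hη
  -- With errors below this threshold, `η / 2` is the fixed point of the bounding affine recursion.
  have hη' : 0 < (1 - α) * (η / 2) := by
    have : 0 < 1 - α := by linarith
    positivity
  obtain ⟨N, hN⟩ := Metric.tendsto_atTop.1 hε _ hη'
  have key : ∀ m, e (N + m) ≤ α ^ m * e N + η / 2 := by
    intro m
    induction m with
    | zero => simp; linarith
    | succ m ih =>
      have h1 := h (N + m)
      have h2 := hN (N + m) (by omega)
      rw [Real.dist_eq, sub_zero] at h2
      have h3 := (abs_lt.1 h2).2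
      have h4 := mul_le_mul_of_nonneg_left ih hα0
      rw [← add_assoc, pow_succ]
      nlinarith
  have hpow : Tendsto (fun m => α ^ m * e N) atTop (𝓝 0) := by
    simpa using (tendsto_pow_atTop_nhds_zero_of_lt_one hα0 hα).mul_const (e N)
  obtain ⟨M, hM⟩ := Metric.tendsto_atTop.1 hpow (η / 2) (by linarith)
  refine ⟨N + M, fun n hn => ?_⟩
  obtain ⟨m, rfl⟩ := Nat.exists_eq_add_of_le (show N ≤ n by omega)
  have h2 := hM m (by omega)
  rw [Real.dist_eq, sub_zero] at h2 ⊢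
  rw [abs_of_nonneg (he _)]
  linarith [key m, (abs_lt.1 h2).2]

/-- If `φ (n + 1) - a n * φ n` converges and the factors `a n` converge and stay in `[0, α]` with
`α < 1`, then `φ` converges. -/
theorem exists_tendsto_of_tendsto_sub_mul {φ a : ℕ → ℝ} {α aInf u : ℝ} (hα0 : 0 ≤ α) (hα : α < 1)
    (ha : ∀ n, 0 ≤ a n ∧ a n ≤ α) (ha_lim : Tendsto a atTop (𝓝 aInf))
    (hu : Tendsto (fun n => φ (n + 1) - a n * φ n) atTop (𝓝 u)) :
    ∃ l, Tendsto φ atTop (𝓝 l) := by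
  have haInf : aInf ≤ α := le_of_tendsto' ha_lim fun n => (ha n).2
  have hne : 1 - aInf ≠ 0 := by linarith
  -- The limit must solve `l - aInf * l = u`; the distance to it then contracts by `α` up to a
  -- vanishing error.
  refine ⟨u / (1 - aInf), ?_⟩
  set l := u / (1 - aInf) with hl
  have hul : u = (1 - aInf) * l := by rw [hl]; field_simp
  have hε : Tendsto (fun n => |φ (n + 1) - a n * φ n - (1 - a n) * l|) atTop (𝓝 0) := by
    have h1 : Tendsto (fun n => (1 - a n) * l) atTop (𝓝 ((1 - aInf) * l)) :=
      (tendsto_const_nhds.sub ha_lim).mul_const l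
    have h2 := (hu.sub h1).abs
    rwa [hul, sub_self, abs_zero] at h2
  have he := tendsto_zero_of_le_mul_add (e := fun n => |φ n - l|) hα0 hα (fun n => abs_nonneg _)
    hε fun n => by
      have h1 : φ (n + 1) - l
          = a n * (φ n - l) + (φ (n + 1) - a n * φ n - (1 - a n) * l) := by ring
      have h2 := abs_add_le (a n * (φ n - l)) (φ (n + 1) - a n * φ n - (1 - a n) * l)
      rw [← h1, abs_mul, abs_of_nonneg (ha n).1] at h2
      exact h2.trans (add_le_add (mul_le_mul_of_nonneg_right (ha n).2 (abs_nonneg _)) le_rfl)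
  have := (tendsto_zero_iff_abs_tendsto_zero _).2 he
  simpa using this.add_const l

/-- Boundedness of `p` and of the partial sums of `d`, for a Lyapunov sequence `m` that decreases
by at least `θ * d (n + 1)` at each step and satisfies `p (n + 1) - α * p n ≤ m n`. -/
theorem bounded_of_lyapunov {p d m : ℕ → ℝ} {α θ : ℝ} (hα0 : 0 ≤ α) (hα : α < 1) (hθ : 0 < θ)
    (hd : ∀ n, 0 ≤ d n) (hp : ∀ n, 0 ≤ p n) (hpm : ∀ n, p (n + 1) - α * p n ≤ m n)
    (hm : ∀ n, m (n + 1) + θ * d (n + 1) ≤ m n) :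
    (∃ C, ∀ n, p n ≤ C) ∧ Summable d := by
  have hmono : ∀ n, m n ≤ m 0 := by
    intro n
    induction n with
    | zero => exact le_rfl
    | succ n ih => have := hm n; have := mul_nonneg hθ.le (hd (n + 1)); linarith
  -- Chosen so that `p 0 ≤ C` and `α * C + |m 0| ≤ C`, which makes the bound inductive.
  set C := p 0 + |m 0| / (1 - α) with hC
  have h1α : 0 < 1 - α := by linarith
  have hCm : |m 0| ≤ (1 - α) * C := by
    have h1 : (1 - α) * C = (1 - α) * p 0 + |m 0| := by rw [hC]; field_simp
    have := mul_nonneg h1α.le (hp 0)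
    linarith
  have hbound : ∀ n, p n ≤ C := by
    intro n
    induction n with
    | zero => have : 0 ≤ |m 0| / (1 - α) := by positivity
              linarith
    | succ n ih =>
      have := hpm n
      have := hmono n
      have := mul_le_mul_of_nonneg_left ih hα0
      have := le_abs_self (m 0)
      linarith
  refine ⟨⟨C, hbound⟩, ?_⟩
  have hsum : ∀ n, m n + θ * ∑ i ∈ Finset.range n, d (i + 1) ≤ m 0 := by
    intro n
    induction n with
    | zero => simp
    | succ n ih => rw [Finset.sum_range_succ]; have := hm n; linarith
  rw [← summable_nat_add_iff 1]
  -- Since `p ≥ 0`, the Lyapunov sequence is bounded below by `-α * C`, so its total decrease is at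
  -- most `m 0 + α * C`.
  refine summable_of_sum_range_le (c := (m 0 + α * C) / θ) (fun n => hd _) fun n => ?_
  rw [le_div_iff₀ hθ]
  have := hsum n
  have := hpm n
  have := hp (n + 1)
  have := mul_le_mul_of_nonneg_left (hbound n) hα0
  linarith

/-- The relaxation bound makes the step sizes smaller than one. -/
theorem relaxation_lt_one {α θ δ r : ℝ} (hα0 : 0 ≤ α) (hθ : 0 < θ) (hδ : 0 < δ)
    (hr : r < (δ - α * (α * (1 + α) + α * δ + θ)) / (δ * (1 + α * (1 + α) + α * δ + θ))) :
    r < 1 := by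
  refine hr.trans_le ?_
  rw [div_le_one (by positivity)]
  have : 0 ≤ α * (α * (1 + α) + α * δ + θ) := by positivity
  have : 0 ≤ δ * (α * (1 + α) + α * δ + θ) := by positivity
  linarith

/-- One step of the Lyapunov estimate of the inertial iteration, in scalar form. -/
theorem lyapunov_step {φ₀ φ₁ φ₂ d₀ d₁ Ny Nxy S a a' r r' α θ δ : ℝ} (hφ₁ : 0 ≤ φ₁) (hd₁ : 0 ≤ d₁)
    (hstep : r * φ₂ + (1 - r) * Nxy = r * Ny + r ^ 2 * S)
    (hNy : Ny = (1 + a) * φ₁ - a * φ₀ + a * (1 + a) * d₀)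
    (hNxy : (1 - a / (a + δ * r)) * d₁ + (a ^ 2 - a * (a + δ * r)) * d₀ ≤ Nxy)
    (ha : 0 ≤ a) (haa' : a ≤ a') (ha' : a' ≤ α) (hr : 0 < r) (hr' : 0 < r') (hr'1 : r' < 1)
    (hθ : 0 < θ) (hδ : 0 < δ)
    (hr_bound : r < (δ - α * (α * (1 + α) + α * δ + θ)) / (δ * (1 + α * (1 + α) + α * δ + θ))) :
    (φ₂ - a' * φ₁ + (a' * (1 + a') + a' * (1 - r') * δ) * d₁) + θ * d₁
      ≤ (φ₁ - a * φ₀ + (a * (1 + a) + a * (1 - r) * δ) * d₀) + r * S := by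
  have hα0 : 0 ≤ α := by linarith
  have hr1 : r < 1 := relaxation_lt_one hα0 hθ hδ hr_bound
  have hc : 0 < a + δ * r := by positivity
  have hγ : a' * (1 + a') + a' * (1 - r') * δ + θ ≤ α * (1 + α) + α * δ + θ := by
    have h1 : a' * (1 + a') ≤ α * (1 + α) := by gcongr; linarith
    have h2 : a' * (1 - r') * δ ≤ α * 1 * δ := by
      gcongr
      linarith
    linarith
  -- With `M` the left side, the relaxation bound rearranges to `M * (α + δ * r) < δ * (1 - r)`.
  have hM : α * (1 + α) + α * δ + θ ≤ (1 - r) * δ / (a + δ * r) := by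
    rw [lt_div_iff₀ (by positivity)] at hr_bound
    rw [le_div_iff₀ hc]
    have : a * (α * (1 + α) + α * δ + θ) ≤ α * (α * (1 + α) + α * δ + θ) := by
      gcongr; linarith
    linarith
  have hφ₂ : φ₂ = Ny + r * S - (1 - r) / r * Nxy := by
    field_simp
    linarith
  -- The Young parameter `a + δ * r` is chosen so that the `d₀` coefficient matches the Lyapunov
  -- function's term `a * (1 - r) * δ`.
  have h1 : (1 - r) / r * ((1 - a / (a + δ * r)) * d₁ + (a ^ 2 - a * (a + δ * r)) * d₀)
      = (1 - r) * δ / (a + δ * r) * d₁ - a * (1 - r) * δ * d₀ := by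
    field_simp
    ring
  have h2 := mul_le_mul_of_nonneg_left hNxy (show 0 ≤ (1 - r) / r from
    div_nonneg (by linarith) hr.le)
  rw [h1] at h2
  have h3 := mul_le_mul_of_nonneg_right (hγ.trans hM) hd₁
  -- Monotonicity of the inertial parameters allows `a` to be replaced by `a'` in front of `φ₁`.
  have h4 := mul_le_mul_of_nonneg_right haa' hφ₁
  rw [hφ₂, hNy]
  linarith

/-! ### Weighted squared norms on a product -/

section WeightedSq

variable {J : ℕ} {Z : Fin J → Type*} [∀ j, NormedAddCommGroup (Z j)]

/-- The weighted squared norm `∑ j, w j * ‖v j‖ ^ 2`. -/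
def weightedSq (w : Fin J → ℝ) (v : PiLp 2 Z) : ℝ := ∑ j, w j * ‖v j‖ ^ 2

theorem weightedSq_nonneg {w : Fin J → ℝ} (hw : ∀ j, 0 ≤ w j) (v : PiLp 2 Z) :
    0 ≤ weightedSq w v :=
  Finset.sum_nonneg fun j _ => mul_nonneg (hw j) (sq_nonneg _)

theorem continuous_weightedSq (w : Fin J → ℝ) : Continuous (weightedSq w : PiLp 2 Z → ℝ) := by
  unfold weightedSq
  fun_prop

theorem sq_norm_le_weightedSq {w : Fin J → ℝ} (hw : ∀ j, 1 ≤ w j) (v : PiLp 2 Z) :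
    ‖v‖ ^ 2 ≤ weightedSq w v := by
  rw [PiLp.norm_sq_eq_of_L2]
  exact Finset.sum_le_sum fun j _ => le_mul_of_one_le_left (sq_nonneg _) (hw j)

theorem weightedSq_sub_le {w : Fin J → ℝ} (hw : ∀ j, 0 ≤ w j) (u v : PiLp 2 Z) :
    weightedSq w (u - v) ≤ 2 * weightedSq w u + 2 * weightedSq w v := by
  unfold weightedSq
  rw [Finset.mul_sum, Finset.mul_sum, ← Finset.sum_add_distrib]
  refine Finset.sum_le_sum fun j _ => ?_
  have h1 : ‖(u - v) j‖ ^ 2 ≤ 2 * ‖u j‖ ^ 2 + 2 * ‖v j‖ ^ 2 := by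
    have h2 : ‖(u - v) j‖ ≤ ‖u j‖ + ‖v j‖ := norm_sub_le _ _
    have h3 := pow_le_pow_left₀ (norm_nonneg _) h2 2
    nlinarith [sq_nonneg (‖u j‖ - ‖v j‖)]
  have := mul_le_mul_of_nonneg_left h1 (hw j)
  linarith

variable [∀ j, InnerProductSpace ℝ (Z j)]

theorem weightedSq_smul (w : Fin J → ℝ) (c : ℝ) (v : PiLp 2 Z) :
    weightedSq w (c • v) = c ^ 2 * weightedSq w v := by
  unfold weightedSq
  rw [Finset.mul_sum]
  refine Finset.sum_congr rfl fun j _ => ?_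
  rw [PiLp.smul_apply, norm_smul, mul_pow, Real.norm_eq_abs, sq_abs]
  ring

theorem weightedSq_extrapolation_sub (w : Fin J → ℝ) (x₀ x₁ z : PiLp 2 Z) (a : ℝ) :
    weightedSq w (x₁ + a • (x₁ - x₀) - z)
      = (1 + a) * weightedSq w (x₁ - z) - a * weightedSq w (x₀ - z)
        + a * (1 + a) * weightedSq w (x₁ - x₀) := by
  unfold weightedSq
  rw [Finset.mul_sum, Finset.mul_sum, Finset.mul_sum, ← Finset.sum_sub_distrib,
    ← Finset.sum_add_distrib]
  refine Finset.sum_congr rfl fun j _ => ?_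
  simp only [PiLp.add_apply, PiLp.sub_apply, PiLp.smul_apply]
  have h1 : x₁ j + a • (x₁ j - x₀ j) - z j = (1 + a) • (x₁ j - z j) - a • (x₀ j - z j) := by
    module
  have h2 : x₁ j - x₀ j = (x₁ j - z j) - (x₀ j - z j) := by abel
  rw [h1, h2]
  generalize x₁ j - z j = u
  generalize x₀ j - z j = v
  rw [norm_sub_sq_real, norm_sub_sq_real, norm_smul, norm_smul, mul_pow, mul_pow,
    Real.norm_eq_abs, Real.norm_eq_abs, sq_abs, sq_abs, real_inner_smul_left,
    real_inner_smul_right]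
  ring

/-- Young's inequality with free parameter `c`: blockwise, the gap is the square `a / c * ‖u - c •
v‖ ^ 2`. -/
theorem le_weightedSq_sub_extrapolation {w : Fin J → ℝ} (hw : ∀ j, 0 ≤ w j) (x₀ x₁ x₂ : PiLp 2 Z)
    {a c : ℝ} (ha : 0 ≤ a) (hc : 0 < c) :
    (1 - a / c) * weightedSq w (x₂ - x₁) + (a ^ 2 - a * c) * weightedSq w (x₁ - x₀)
      ≤ weightedSq w (x₂ - (x₁ + a • (x₁ - x₀))) := by
  unfold weightedSq
  rw [Finset.mul_sum, Finset.mul_sum, ← Finset.sum_add_distrib]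
  refine Finset.sum_le_sum fun j _ => ?_
  simp only [PiLp.add_apply, PiLp.sub_apply, PiLp.smul_apply]
  have h1 : x₂ j - (x₁ j + a • (x₁ j - x₀ j)) = (x₂ j - x₁ j) - a • (x₁ j - x₀ j) := by
    abel
  rw [h1]
  generalize x₂ j - x₁ j = u
  generalize x₁ j - x₀ j = v
  have h2 : ‖u - a • v‖ ^ 2 - ((1 - a / c) * ‖u‖ ^ 2 + (a ^ 2 - a * c) * ‖v‖ ^ 2)
      = a / c * ‖u - c • v‖ ^ 2 := by
    rw [norm_sub_sq_real, norm_sub_sq_real, norm_smul, norm_smul, mul_pow, mul_pow,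
      Real.norm_eq_abs, Real.norm_eq_abs, sq_abs, sq_abs, real_inner_smul_right,
      real_inner_smul_right]
    field_simp
    ring
  have h3 : 0 ≤ a / c * ‖u - c • v‖ ^ 2 := by positivity
  have h4 := mul_nonneg (hw j) (h2 ▸ h3)
  linarith

open Classical in
/-- The relaxed block step moves the component `j` exactly when `j ∈ ϑ`. -/
theorem relaxed_blockOperator_apply (T : PiLp 2 Z → PiLp 2 Z) (ϑ : Set (Fin J)) (y : PiLp 2 Z)
    (r : ℝ) (j : Fin J) :
    (y + r • (blockOperator T ϑ y - y)) j
      = y j + (if j ∈ ϑ then r else 0) • (T y j - y j) := by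
  simp only [blockOperator, PiLp.add_apply, PiLp.sub_apply, PiLp.smul_apply]
  split_ifs <;> simp

-- Expanding squares on a selected block, the term `(1 - r) * ‖x⁺ - y‖ ^ 2` supplies exactly what
-- completes `‖T y j - z j‖ ^ 2`; on the other blocks nothing moves.
open Classical in
theorem weightedSq_relaxed_blockOperator (w : Fin J → ℝ) (T : PiLp 2 Z → PiLp 2 Z)
    (ϑ : Set (Fin J)) (y z : PiLp 2 Z) (r : ℝ) :
    r * weightedSq w (y + r • (blockOperator T ϑ y - y) - z)
        + (1 - r) * weightedSq w (y + r • (blockOperator T ϑ y - y) - y)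
      = r * weightedSq w (y - z) + r ^ 2 * ∑ j, (w j * (‖T y j - z j‖ ^ 2 - ‖y j - z j‖ ^ 2))
          * (if j ∈ ϑ then 1 else 0) := by
  unfold weightedSq
  simp only [Finset.mul_sum]
  rw [← Finset.sum_add_distrib, ← Finset.sum_add_distrib]
  refine Finset.sum_congr rfl fun j _ => ?_
  rw [PiLp.sub_apply, PiLp.sub_apply, PiLp.sub_apply, relaxed_blockOperator_apply]
  have h1 : T y j - z j = (y j - z j) + (T y j - y j) := by abel
  have h2 (c : ℝ) : y j + c • (T y j - y j) - z j = (y j - z j) + c • (T y j - y j) := by abel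
  have h3 (c : ℝ) : y j + c • (T y j - y j) - y j = c • (T y j - y j) := by abel
  rw [h1, h2, h3]
  generalize y j - z j = u
  generalize T y j - y j = v
  split_ifs
  · rw [norm_add_sq_real, norm_add_sq_real, norm_smul, mul_pow, Real.norm_eq_abs, sq_abs,
      real_inner_smul_right]
    ring
  · simp

open Classical in
theorem weightedSq_relaxed_blockOperator_sub (w : Fin J → ℝ) (T : PiLp 2 Z → PiLp 2 Z)
    (ϑ : Set (Fin J)) (y : PiLp 2 Z) (r : ℝ) :
    weightedSq w (y + r • (blockOperator T ϑ y - y) - y)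
      = r ^ 2 * ∑ j, (w j * ‖T y j - y j‖ ^ 2) * (if j ∈ ϑ then 1 else 0) := by
  unfold weightedSq
  rw [Finset.mul_sum]
  refine Finset.sum_congr rfl fun j _ => ?_
  rw [PiLp.sub_apply, relaxed_blockOperator_apply, add_sub_cancel_left, norm_smul, mul_pow]
  split_ifs
  · rw [Real.norm_eq_abs, sq_abs]; ring
  · simp

/-- An Opial-type criterion: a sequence that has asymptotically vanishing residual, and whose
weighted distances to the points of a set whose closure contains all fixed points converge,
converges to a fixed point. -/
theorem tendsto_fixedPoint_of_weightedSq [∀ j, FiniteDimensional ℝ (Z j)] {w : Fin J → ℝ}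
    (hw : ∀ j, 1 ≤ w j) {T : PiLp 2 Z → PiLp 2 Z} (hT : Continuous T) {D : Set (PiLp 2 Z)}
    (hD_ne : D.Nonempty) (hD_dense : Function.fixedPoints T ⊆ closure D) {x : ℕ → PiLp 2 Z}
    (hlim : ∀ z ∈ D, ∃ l, Tendsto (fun n => weightedSq w (x n - z)) atTop (𝓝 l))
    (hres : Tendsto (fun n => T (x n) - x n) atTop (𝓝 0)) :
    ∃ y ∈ Function.fixedPoints T, Tendsto x atTop (𝓝 y) := by
  have hw0 : ∀ j, 0 ≤ w j := fun j => zero_le_one.trans (hw j)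
  obtain ⟨z₀, hz₀⟩ := hD_ne
  obtain ⟨l₀, hl₀⟩ := hlim z₀ hz₀
  obtain ⟨C, hC⟩ := hl₀.bddAbove_range
  have hmem : ∀ n, x n ∈ Metric.closedBall z₀ (Real.sqrt C) := by
    intro n
    rw [Metric.mem_closedBall, dist_eq_norm]
    exact Real.le_sqrt_of_sq_le ((sq_norm_le_weightedSq hw _).trans (hC ⟨n, rfl⟩))
  obtain ⟨y, -, ψ, hψ, hy⟩ := tendsto_subseq_of_bounded Metric.isBounded_closedBall hmem
  have hyT : T y = y := by
    have h1 : Tendsto (fun n => T (x (ψ n)) - x (ψ n)) atTop (𝓝 (T y - y)) :=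
      ((hT.tendsto y).comp hy).sub hy
    exact sub_eq_zero.1 (tendsto_nhds_unique h1 (hres.comp hψ.tendsto_atTop))
  refine ⟨y, hyT, ?_⟩
  rw [tendsto_iff_norm_sub_tendsto_zero, Metric.tendsto_atTop]
  intro ε hε
  have hcont : Tendsto (fun z => weightedSq w (y - z)) (𝓝 y) (𝓝 0) := by
    have h := ((continuous_weightedSq w).comp (continuous_const.sub continuous_id :
      Continuous fun z : PiLp 2 Z => y - z)).tendsto y
    simpa [weightedSq, Function.comp_def] using h
  -- The cluster point `y` need not lie in `D`, so it is compared with a nearby `z ∈ D`; the factors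
  -- 2 in `weightedSq_sub_le` turn two errors of `ε ^ 2 / 4` into `ε ^ 2`.
  have hη : 0 < ε ^ 2 / 4 := by positivity
  have hev : ∀ᶠ z in 𝓝 y, weightedSq w (y - z) < ε ^ 2 / 4 := hcont.eventually (gt_mem_nhds hη)
  obtain ⟨z, hzD, hz⟩ :=
    ((mem_closure_iff_frequently.1 (hD_dense hyT)).and_eventually hev).exists
  obtain ⟨l, hl⟩ := hlim z hzD
  have hl_eq : l = weightedSq w (y - z) :=
    tendsto_nhds_unique (hl.comp hψ.tendsto_atTop)
      (((continuous_weightedSq w).tendsto _).comp (hy.sub_const z))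
  obtain ⟨N, hN⟩ := eventually_atTop.1 (hl.eventually (gt_mem_nhds (hl_eq ▸ hz)))
  refine ⟨N, fun n hn => ?_⟩
  rw [Real.dist_eq, sub_zero, abs_of_nonneg (norm_nonneg _)]
  refine lt_of_pow_lt_pow_left₀ 2 hε.le ?_
  have h1 := weightedSq_sub_le hw0 (x n - z) (y - z)
  rw [sub_sub_sub_cancel_right] at h1
  have h2 := sq_norm_le_weightedSq hw (x n - y)
  have h3 := hN n hn
  linarith

end WeightedSq

/-! ### Random block selections -/

section Selection

variable {J : ℕ} {Ω : Type*} [mΩ : MeasurableSpace Ω] {P : Measure Ω}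

/-- The filtration whose `n`-th member is generated by the selections `ζ i` with `i < n`. -/
def selectionFiltration (ζ : ℕ → Ω → Set (Fin J)) (hζ : ∀ n, Measurable (ζ n)) :
    Filtration ℕ mΩ where
  seq n := ⨆ i ∈ Set.Iio n, MeasurableSpace.comap (ζ i) inferInstance
  mono' _ _ hmn := biSup_mono fun _ hi => lt_of_lt_of_le hi hmn
  le' _ := iSup₂_le fun i _ => (hζ i).comap_le

variable {ζ : ℕ → Ω → Set (Fin J)} (hζ : ∀ n, Measurable (ζ n))

theorem measurable_selection (n : ℕ) : Measurable[selectionFiltration ζ hζ (n + 1)] (ζ n) := by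
  rw [measurable_iff_comap_le]
  exact le_iSup₂ (f := fun i (_ : i ∈ Set.Iio (n + 1)) =>
    MeasurableSpace.comap (ζ i) inferInstance) n (Nat.lt_succ_self n)

theorem measurableSet_mem_selection {ξ : Ω → Set (Fin J)} (hξ : Measurable ξ) (j : Fin J) :
    MeasurableSet {ω | j ∈ ξ ω} :=
  measurableSet_setOfPred.2 ((measurable_set_mem j).comp hξ)

theorem indep_selectionFiltration (hind : iIndepFun ζ P) (n : ℕ) :
    Indep (selectionFiltration ζ hζ n) (MeasurableSpace.comap (ζ n) inferInstance) P := by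
  have h := indep_iSup_of_disjoint (fun i => (hζ i).comap_le) hind.iIndep
    (show Disjoint (Set.Iio n) {n} by simp)
  rwa [iSup_singleton] at h

open Classical in
/-- A random variable determined by the past is uncorrelated with the event that the block `j` is
selected next. -/
theorem integral_mul_selection [IsProbabilityMeasure P] (hind : iIndepFun ζ P) (n : ℕ) (j : Fin J)
    {f : Ω → ℝ} (hf : StronglyMeasurable[selectionFiltration ζ hζ n] f) :
    ∫ ω, f ω * (if j ∈ ζ n ω then 1 else 0) ∂P = (∫ ω, f ω ∂P) * P.real {ω | j ∈ ζ n ω} := by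
  have hmeas : Measurable fun s : Set (Fin J) => (if j ∈ s then 1 else 0 : ℝ) :=
    Measurable.ite (measurableSet_setOfPred.2 (measurable_set_mem j)) measurable_const
      measurable_const
  have hindep : IndepFun f (fun ω => (if j ∈ ζ n ω then 1 else 0 : ℝ)) P := by
    rw [IndepFun_iff_Indep]
    refine indep_of_indep_of_le_left (indep_of_indep_of_le_right
      (indep_selectionFiltration hζ hind n) ?_) hf.measurable.comap_le
    rintro _ ⟨s, hs, rfl⟩
    exact ⟨_, hmeas hs, rfl⟩
  rw [hindep.integral_fun_mul_eq_mul_integral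
    (hf.mono ((selectionFiltration ζ hζ).le n)).aestronglyMeasurable
    (hmeas.comp (hζ n)).aestronglyMeasurable]
  congr 1
  rw [← integral_indicator_one (measurableSet_mem_selection (hζ n) j)]
  refine integral_congr_ae (ae_of_all _ fun ω => ?_)
  simp [Set.indicator_apply]

open Classical in
/-- Selecting the blocks at random and weighting them by the inverse selection probabilities does
not change the conditional mean given the past. -/
theorem setIntegral_sum_selection [IsProbabilityMeasure P] (hind : iIndepFun ζ P) (n : ℕ)
    {q : Fin J → ℝ} (hq : ∀ j, P.real {ω | j ∈ ζ n ω} = q j) (hq0 : ∀ j, 0 < q j)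
    {c : Fin J → Ω → ℝ} (hc : ∀ j, StronglyMeasurable[selectionFiltration ζ hζ n] (c j))
    (hc_int : ∀ j, Integrable (c j) P) {A : Set Ω}
    (hA : MeasurableSet[selectionFiltration ζ hζ n] A) :
    ∫ ω in A, ∑ j, ((q j)⁻¹ * c j ω) * (if j ∈ ζ n ω then 1 else 0) ∂P
      = ∫ ω in A, ∑ j, c j ω ∂P := by
  have hA' : MeasurableSet A := (selectionFiltration ζ hζ).le n A hA
  have hint : ∀ j, Integrable
      (fun ω => ((q j)⁻¹ * c j ω) * (if j ∈ ζ n ω then 1 else 0)) P := by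
    intro j
    have h := ((hc_int j).const_mul (q j)⁻¹).indicator (measurableSet_mem_selection (hζ n) j)
    refine h.congr (ae_of_all _ fun ω => ?_)
    simp [Set.indicator_apply]
  rw [integral_finsetSum _ fun j _ => (hint j).integrableOn,
    integral_finsetSum _ fun j _ => (hc_int j).integrableOn]
  refine Finset.sum_congr rfl fun j _ => ?_
  -- The indicator of the past event `A` is absorbed into the factor determined by the past.
  have h := integral_mul_selection hζ hind n j
    (((hc j).const_mul (q j)⁻¹).indicator hA)
  rw [← integral_indicator hA']
  have h1 : (A.indicator fun ω => ((q j)⁻¹ * c j ω) * (if j ∈ ζ n ω then 1 else 0 : ℝ))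
      = fun ω => A.indicator (fun ω => (q j)⁻¹ * c j ω) ω * (if j ∈ ζ n ω then 1 else 0 : ℝ) := by
    ext ω
    by_cases hω : ω ∈ A <;> simp [hω]
  rw [h1, h, hq, integral_indicator hA', integral_const_mul]
  have := (hq0 j).ne'
  field_simp

end Selection

/-! ### Integrability and summable means -/

/-- A strongly measurable real function with finite range is integrable for a finite measure. -/
theorem integrable_of_finite_range {Ω : Type*} [MeasurableSpace Ω] {P : Measure Ω}
    [IsFiniteMeasure P] {f : Ω → ℝ} (hf : StronglyMeasurable f) (hfin : (Set.range f).Finite) :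
    Integrable f P := by
  obtain ⟨C, hC⟩ := hfin.isBounded.exists_norm_le
  exact Integrable.of_bound hf.aestronglyMeasurable C (ae_of_all _ fun ω => hC _ ⟨ω, rfl⟩)

/-- Nonnegative integrable functions with summable integrals tend to zero almost everywhere. -/
theorem ae_tendsto_zero_of_summable_integral {Ω : Type*} [MeasurableSpace Ω] {P : Measure Ω}
    {f : ℕ → Ω → ℝ} (hf : ∀ n, Integrable (f n) P) (hf0 : ∀ n ω, 0 ≤ f n ω)
    (hsum : Summable fun n => ∫ ω, f n ω ∂P) :
    ∀ᵐ ω ∂P, Tendsto (fun n => f n ω) atTop (𝓝 0) := by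
  have h1 : ∫⁻ ω, ∑' n, ENNReal.ofReal (f n ω) ∂P ≠ ⊤ := by
    rw [lintegral_tsum fun n => (hf n).aestronglyMeasurable.aemeasurable.ennreal_ofReal]
    have h2 : ∀ n, ∫⁻ ω, ENNReal.ofReal (f n ω) ∂P = ENNReal.ofReal (∫ ω, f n ω ∂P) := fun n =>
      (ofReal_integral_eq_lintegral_ofReal (hf n) (ae_of_all _ (hf0 n))).symm
    simp_rw [h2]
    exact hsum.tsum_ofReal_ne_top
  filter_upwards [ae_lt_top' (AEMeasurable.tsum fun n =>
    (hf n).aestronglyMeasurable.aemeasurable.ennreal_ofReal) h1] with ω hω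
  have h3 := (ENNReal.tendsto_toReal ENNReal.zero_ne_top).comp
    (ENNReal.tendsto_atTop_zero_of_tsum_ne_top hω.ne)
  refine h3.congr fun n => ?_
  simp [ENNReal.toReal_ofReal (hf0 n ω)]

/-! ### The iteration -/

section Iteration

variable {J : ℕ} {Z : Fin J → Type*} [∀ j, NormedAddCommGroup (Z j)]

theorem continuous_blockOperator {T : PiLp 2 Z → PiLp 2 Z} (hT : Continuous T)
    (ϑ : Set (Fin J)) : Continuous (blockOperator T ϑ) := by
  unfold blockOperator
  refine (PiLp.continuous_toLp 2 _).comp (continuous_pi fun j => ?_)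
  split_ifs <;> fun_prop

variable [∀ j, InnerProductSpace ℝ (Z j)] {Ω : Type*}

/-- The inertial extrapolation of two successive iterates. -/
def extrapolate (a : ℝ) (u v : PiLp 2 Z) : PiLp 2 Z := v + a • (v - u)

/-- `x` is produced by the relaxed inertial block iteration with deterministic initial points:
`ζ n` is the set of blocks updated when passing from `x (n + 1)` to `x (n + 2)`. -/
structure IsInertialBlockIteration (T : PiLp 2 Z → PiLp 2 Z) (ζ : ℕ → Ω → Set (Fin J))
    (a r : ℕ → ℝ) (x : ℕ → Ω → PiLp 2 Z) : Prop where
  zero : ∃ c, ∀ ω, x 0 ω = c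
  one : ∃ c, ∀ ω, x 1 ω = c
  step : ∀ n ω, x (n + 2) ω = extrapolate (a n) (x n ω) (x (n + 1) ω)
    + r n • (blockOperator T (ζ n ω) (extrapolate (a n) (x n ω) (x (n + 1) ω))
      - extrapolate (a n) (x n ω) (x (n + 1) ω))

theorem continuous_extrapolate (a : ℝ) :
    Continuous fun p : PiLp 2 Z × PiLp 2 Z => extrapolate a p.1 p.2 := by
  unfold extrapolate
  fun_prop

namespace IsInertialBlockIteration

variable {T : PiLp 2 Z → PiLp 2 Z} {ζ : ℕ → Ω → Set (Fin J)} {a r : ℕ → ℝ}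
  {x : ℕ → Ω → PiLp 2 Z}

/-- Deterministic starting points and finitely many block sets leave finitely many possible iterates
at each time, so integrability needs no moment estimates. -/
theorem finite_range (hx : IsInertialBlockIteration T ζ a r x) (n : ℕ) :
    (Set.range fun ω => (x n ω, x (n + 1) ω)).Finite := by
  induction n with
  | zero =>
    obtain ⟨c₀, h₀⟩ := hx.zero
    obtain ⟨c₁, h₁⟩ := hx.one
    refine (Set.finite_singleton (c₀, c₁)).subset ?_
    rintro _ ⟨ω, rfl⟩
    simp [h₀, h₁]
  | succ n ih =>
    refine ((ih.prod (Set.finite_univ (α := Set (Fin J)))).image fun p =>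
      (p.1.2, extrapolate (a n) p.1.1 p.1.2 + r n • (blockOperator T p.2
        (extrapolate (a n) p.1.1 p.1.2) - extrapolate (a n) p.1.1 p.1.2))).subset ?_
    rintro _ ⟨ω, rfl⟩
    exact ⟨((x n ω, x (n + 1) ω), ζ n ω), ⟨⟨ω, rfl⟩, Set.mem_univ _⟩, by simp [hx.step]⟩

variable [mΩ : MeasurableSpace Ω]

theorem stronglyMeasurable_pair (hx : IsInertialBlockIteration T ζ a r x) (hT : Continuous T)
    (hζ : ∀ n, Measurable (ζ n)) (n : ℕ) :
    StronglyMeasurable[selectionFiltration ζ hζ n] fun ω => (x n ω, x (n + 1) ω) := by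
  classical
  induction n with
  | zero =>
    obtain ⟨c₀, h₀⟩ := hx.zero
    obtain ⟨c₁, h₁⟩ := hx.one
    simp only [h₀, zero_add, h₁]
    exact stronglyMeasurable_const
  | succ n ih =>
    have ih' := ih.mono ((selectionFiltration ζ hζ).mono n.le_succ)
    have hy : StronglyMeasurable[selectionFiltration ζ hζ (n + 1)]
        fun ω => extrapolate (a n) (x n ω) (x (n + 1) ω) :=
      (continuous_extrapolate (a n)).comp_stronglyMeasurable ih'
    have hb : StronglyMeasurable[selectionFiltration ζ hζ (n + 1)] fun ω =>
        blockOperator T (ζ n ω) (extrapolate (a n) (x n ω) (x (n + 1) ω)) := by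
      -- Splitting over the finitely many values of `ζ n` reduces joint measurability to continuity
      -- of each block operator.
      have h1 : (fun ω => blockOperator T (ζ n ω) (extrapolate (a n) (x n ω) (x (n + 1) ω)))
          = fun ω => ∑ ϑ : Set (Fin J), if ζ n ω = ϑ then
            blockOperator T ϑ (extrapolate (a n) (x n ω) (x (n + 1) ω)) else 0 := by
        ext1 ω
        rw [Finset.sum_ite_eq Finset.univ (ζ n ω)]
        simp
      rw [h1]
      refine Finset.stronglyMeasurable_fun_sum _ fun ϑ _ => ?_
      exact StronglyMeasurable.ite (measurable_selection hζ n (measurableSet_singleton ϑ))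
        ((continuous_blockOperator hT ϑ).comp_stronglyMeasurable hy) stronglyMeasurable_const
    simp only [hx.step]
    exact (continuous_snd.comp_stronglyMeasurable ih').prodMk (hy.add ((hb.sub hy).const_smul (r n)))

theorem stronglyMeasurable_comp (hx : IsInertialBlockIteration T ζ a r x) (hT : Continuous T)
    (hζ : ∀ n, Measurable (ζ n)) (n : ℕ) {h : PiLp 2 Z × PiLp 2 Z → ℝ} (hh : Continuous h) :
    StronglyMeasurable[selectionFiltration ζ hζ n] fun ω => h (x n ω, x (n + 1) ω) :=
  hh.comp_stronglyMeasurable (hx.stronglyMeasurable_pair hT hζ n)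

theorem integrable_comp {P : Measure Ω} [IsFiniteMeasure P]
    (hx : IsInertialBlockIteration T ζ a r x) (hT : Continuous T)
    (hζ : ∀ n, Measurable (ζ n)) (n : ℕ) {h : PiLp 2 Z × PiLp 2 Z → ℝ} (hh : Continuous h) :
    Integrable (fun ω => h (x n ω, x (n + 1) ω)) P := by
  refine integrable_of_finite_range
    ((hx.stronglyMeasurable_comp hT hζ n hh).mono ((selectionFiltration ζ hζ).le n)) ?_
  refine ((hx.finite_range n).image h).subset ?_
  rintro _ ⟨ω, rfl⟩
  exact ⟨_, ⟨ω, rfl⟩, rfl⟩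

end IsInertialBlockIteration

end Iteration

/-! ### Parameter bounds -/

/-- The conditions on the inertial parameters `a` and the relaxation parameters `r`. -/
structure InertialParameters (a r : ℕ → ℝ) (α ρ θ δ : ℝ) : Prop where
  mono : Monotone a
  nonneg : ∀ n, 0 ≤ a n
  le : ∀ n, a n ≤ α
  lt_one : α < 1
  rho_pos : 0 < ρ
  theta_pos : 0 < θ
  delta_pos : 0 < δ
  rho_le : ∀ n, ρ ≤ r n
  r_lt : ∀ n, r n <
    (δ - α * (α * (1 + α) + α * δ + θ)) / (δ * (1 + α * (1 + α) + α * δ + θ))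

namespace InertialParameters

variable {a r : ℕ → ℝ} {α ρ θ δ : ℝ}

theorem alpha_nonneg (h : InertialParameters a r α ρ θ δ) : 0 ≤ α := (h.nonneg 0).trans (h.le 0)

theorem r_pos (h : InertialParameters a r α ρ θ δ) (n : ℕ) : 0 < r n :=
  h.rho_pos.trans_le (h.rho_le n)

theorem r_lt_one (h : InertialParameters a r α ρ θ δ) (n : ℕ) : r n < 1 :=
  relaxation_lt_one h.alpha_nonneg h.theta_pos h.delta_pos (h.r_lt n)

theorem coeff_nonneg (h : InertialParameters a r α ρ θ δ) (n : ℕ) :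
    0 ≤ a n * (1 + a n) + a n * (1 - r n) * δ := by
  have := h.nonneg n
  have := h.r_lt_one n
  have := h.delta_pos
  have : 0 ≤ 1 - r n := by linarith
  positivity

theorem coeff_le (h : InertialParameters a r α ρ θ δ) (n : ℕ) :
    a n * (1 + a n) + a n * (1 - r n) * δ ≤ 2 + δ := by
  have h1 : a n ≤ 1 := (h.le n).trans h.lt_one.le
  have h0 := h.nonneg n
  have h2 := h.r_lt_one n
  have h3 := h.r_pos n
  have h4 := h.delta_pos
  have h5 : a n * (1 + a n) ≤ 1 * (1 + 1) := by gcongr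
  have h6 : a n * (1 - r n) * δ ≤ 1 * 1 * δ := by
    gcongr
    linarith
  linarith

end InertialParameters

/-! ### Supermartingale argument and almost sure convergence -/

section Convergence

variable {J : ℕ} {Z : Fin J → Type*} [∀ j, NormedAddCommGroup (Z j)]

theorem continuous_weightedSq_snd_sub (w : Fin J → ℝ) (z : PiLp 2 Z) :
    Continuous fun p : PiLp 2 Z × PiLp 2 Z => weightedSq w (p.2 - z) :=
  (continuous_weightedSq w).comp (by fun_prop)

theorem continuous_weightedSq_fst_sub (w : Fin J → ℝ) (z : PiLp 2 Z) :
    Continuous fun p : PiLp 2 Z × PiLp 2 Z => weightedSq w (p.1 - z) :=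
  (continuous_weightedSq w).comp (by fun_prop)

theorem continuous_weightedSq_diff (w : Fin J → ℝ) :
    Continuous fun p : PiLp 2 Z × PiLp 2 Z => weightedSq w (p.2 - p.1) :=
  (continuous_weightedSq w).comp (by fun_prop)

/-- The Lyapunov function of the inertial iteration at a pair of successive iterates. -/
def lyapunov (w : Fin J → ℝ) (a r δ : ℝ) (z : PiLp 2 Z) (p : PiLp 2 Z × PiLp 2 Z) : ℝ :=
  weightedSq w (p.2 - z) - a * weightedSq w (p.1 - z)
    + (a * (1 + a) + a * (1 - r) * δ) * weightedSq w (p.2 - p.1)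

theorem continuous_lyapunov (w : Fin J → ℝ) (a r δ : ℝ) (z : PiLp 2 Z) :
    Continuous (lyapunov w a r δ z) :=
  ((continuous_weightedSq_snd_sub w z).sub
    (continuous_const.mul (continuous_weightedSq_fst_sub w z))).add
    (continuous_const.mul (continuous_weightedSq_diff w))

namespace IsInertialBlockIteration

variable [∀ j, InnerProductSpace ℝ (Z j)] {Ω : Type*} {T : PiLp 2 Z → PiLp 2 Z} {ζ : ℕ → Ω → Set (Fin J)}
  {a r : ℕ → ℝ} {x : ℕ → Ω → PiLp 2 Z} {α ρ θ δ : ℝ} {q w : Fin J → ℝ} {z : PiLp 2 Z}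

open Classical in
/-- Pathwise decrease of the Lyapunov function, up to a term with nonpositive conditional mean. -/
theorem lyapunov_succ_le (hx : IsInertialBlockIteration T ζ a r x)
    (hpar : InertialParameters a r α ρ θ δ) (hw : ∀ j, 0 ≤ w j) (n : ℕ) (ω : Ω) :
    lyapunov w (a (n + 1)) (r (n + 1)) δ z (x (n + 1) ω, x (n + 2) ω)
        + θ * weightedSq w (x (n + 2) ω - x (n + 1) ω)
      ≤ lyapunov w (a n) (r n) δ z (x n ω, x (n + 1) ω)
        + r n * ∑ j, (w j * (‖T (extrapolate (a n) (x n ω) (x (n + 1) ω)) j - z j‖ ^ 2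
            - ‖extrapolate (a n) (x n ω) (x (n + 1) ω) j - z j‖ ^ 2))
          * (if j ∈ ζ n ω then 1 else 0) := by
  have hstep := weightedSq_relaxed_blockOperator w T (ζ n ω)
    (extrapolate (a n) (x n ω) (x (n + 1) ω)) z (r n)
  rw [← hx.step n ω] at hstep
  exact lyapunov_step (weightedSq_nonneg hw _) (weightedSq_nonneg hw _) hstep
    (weightedSq_extrapolation_sub w _ _ _ _)
    (le_weightedSq_sub_extrapolation hw _ _ _ (hpar.nonneg n)
      (add_pos_of_nonneg_of_pos (hpar.nonneg n) (mul_pos hpar.delta_pos (hpar.r_pos n))))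
    (hpar.nonneg n) (hpar.mono n.le_succ) (hpar.le _) (hpar.r_pos n) (hpar.r_pos _)
    (hpar.r_lt_one _) hpar.theta_pos hpar.delta_pos (hpar.r_lt n)

variable [mΩ : MeasurableSpace Ω] {P : Measure Ω} [IsProbabilityMeasure P]

/-- The Lyapunov function decreases in conditional mean. -/
theorem setIntegral_lyapunov_succ_le (hx : IsInertialBlockIteration T ζ a r x)
    (hpar : InertialParameters a r α ρ θ δ) (hT : LipschitzWith 1 T) (hz : T z = z)
    (hζ : ∀ n, Measurable (ζ n)) (hind : iIndepFun ζ P)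
    (hq : ∀ n j, P.real {ω | j ∈ ζ n ω} = q j) (hq0 : ∀ j, 0 < q j) (n : ℕ) {A : Set Ω}
    (hA : MeasurableSet[selectionFiltration ζ hζ n] A) :
    ∫ ω in A, lyapunov (fun j => (q j)⁻¹) (a (n + 1)) (r (n + 1)) δ z (x (n + 1) ω, x (n + 2) ω) ∂P
        + θ * ∫ ω in A, weightedSq (fun j => (q j)⁻¹) (x (n + 2) ω - x (n + 1) ω) ∂P
      ≤ ∫ ω in A, lyapunov (fun j => (q j)⁻¹) (a n) (r n) δ z (x n ω, x (n + 1) ω) ∂P := by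
  classical
  set w : Fin J → ℝ := fun j => (q j)⁻¹ with hw_def
  have hw : ∀ j, 0 ≤ w j := fun j => (inv_pos.2 (hq0 j)).le
  have hA' : MeasurableSet A := (selectionFiltration ζ hζ).le n A hA
  let h : Fin J → PiLp 2 Z × PiLp 2 Z → ℝ := fun j p =>
    ‖T (extrapolate (a n) p.1 p.2) j - z j‖ ^ 2 - ‖extrapolate (a n) p.1 p.2 j - z j‖ ^ 2
  have hh : ∀ j, Continuous (h j) := by
    intro j
    have h1 := continuous_extrapolate (Z := Z) (a n)
    have h2 := hT.continuous.comp h1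
    have h3 : Continuous fun p : PiLp 2 Z × PiLp 2 Z => T (extrapolate (a n) p.1 p.2) j :=
      (PiLp.continuous_apply 2 _ j).comp h2
    have h4 : Continuous fun p : PiLp 2 Z × PiLp 2 Z => extrapolate (a n) p.1 p.2 j :=
      (PiLp.continuous_apply 2 _ j).comp h1
    exact ((h3.sub continuous_const).norm.pow 2).sub ((h4.sub continuous_const).norm.pow 2)
  let c : Fin J → Ω → ℝ := fun j ω => h j (x n ω, x (n + 1) ω)
  have hc : ∀ j, Integrable (c j) P := fun j => hx.integrable_comp hT.continuous hζ n (hh j)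
  have hmean := setIntegral_sum_selection hζ hind n (hq n) hq0
    (fun j => hx.stronglyMeasurable_comp hT.continuous hζ n (hh j)) hc hA
  have hneg : ∫ ω in A, ∑ j, c j ω ∂P ≤ 0 := by
    refine integral_nonpos fun ω => ?_
    have h1 : ∑ j, c j ω = ‖T (extrapolate (a n) (x n ω) (x (n + 1) ω)) - z‖ ^ 2
        - ‖extrapolate (a n) (x n ω) (x (n + 1) ω) - z‖ ^ 2 := by
      rw [PiLp.norm_sq_eq_of_L2, PiLp.norm_sq_eq_of_L2, ← Finset.sum_sub_distrib]
      rfl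
    have h2 := hT.dist_le_mul (extrapolate (a n) (x n ω) (x (n + 1) ω)) z
    rw [hz, dist_eq_norm, dist_eq_norm, NNReal.coe_one, one_mul] at h2
    have h3 := pow_le_pow_left₀ (norm_nonneg _) h2 2
    simp only [h1, Pi.zero_apply]
    linarith
  have hL (m : ℕ) : Integrable (fun ω => lyapunov w (a m) (r m) δ z (x m ω, x (m + 1) ω)) P :=
    hx.integrable_comp hT.continuous hζ m (continuous_lyapunov w _ _ _ z)
  have hd : Integrable (fun ω => weightedSq w (x (n + 2) ω - x (n + 1) ω)) P :=
    hx.integrable_comp hT.continuous hζ (n + 1) (continuous_weightedSq_diff w)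
  have hS : Integrable
      (fun ω => ∑ j, (w j * c j ω) * (if j ∈ ζ n ω then 1 else 0 : ℝ)) P := by
    refine integrable_finsetSum _ fun j _ => ?_
    refine (((hc j).const_mul (w j)).indicator (measurableSet_mem_selection (hζ n) j)).congr
      (ae_of_all _ fun ω => ?_)
    simp [Set.indicator_apply]
  rw [← integral_const_mul, ← integral_add (hL (n + 1)).integrableOn (hd.const_mul θ).integrableOn]
  refine (integral_mono ((hL (n + 1)).integrableOn.add (hd.const_mul θ).integrableOn)
    ((hL n).integrableOn.add (hS.const_mul (r n)).integrableOn)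
    fun ω => hx.lyapunov_succ_le hpar hw n ω).trans ?_
  simp only [Pi.add_apply]
  rw [integral_add (hL n).integrableOn (hS.const_mul (r n)).integrableOn, integral_const_mul,
    hmean]
  have := mul_nonneg (hpar.r_pos n).le (neg_nonneg.2 hneg)
  linarith

/-- The mean distances to a fixed point are bounded, and the mean squared increments are
summable. -/
theorem integral_bounded (hx : IsInertialBlockIteration T ζ a r x)
    (hpar : InertialParameters a r α ρ θ δ) (hT : LipschitzWith 1 T) (hz : T z = z)
    (hζ : ∀ n, Measurable (ζ n)) (hind : iIndepFun ζ P)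
    (hq : ∀ n j, P.real {ω | j ∈ ζ n ω} = q j) (hq0 : ∀ j, 0 < q j) :
    (∃ C, ∀ n, ∫ ω, weightedSq (fun j => (q j)⁻¹) (x n ω - z) ∂P ≤ C) ∧
      Summable fun n => ∫ ω, weightedSq (fun j => (q j)⁻¹) (x (n + 1) ω - x n ω) ∂P := by
  set w : Fin J → ℝ := fun j => (q j)⁻¹ with hw_def
  have hw : ∀ j, 0 ≤ w j := fun j => (inv_pos.2 (hq0 j)).le
  refine bounded_of_lyapunov (m := fun n =>
      ∫ ω, lyapunov w (a n) (r n) δ z (x n ω, x (n + 1) ω) ∂P) hpar.alpha_nonneg hpar.lt_one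
    hpar.theta_pos (fun n => integral_nonneg fun ω => weightedSq_nonneg hw _)
    (fun n => integral_nonneg fun ω => weightedSq_nonneg hw _) (fun n => ?_) (fun n => ?_)
  · have h1 : Integrable (fun ω => weightedSq w (x (n + 1) ω - z)) P :=
      hx.integrable_comp hT.continuous hζ n (continuous_weightedSq_snd_sub w z)
    have h0 : Integrable (fun ω => weightedSq w (x n ω - z)) P :=
      hx.integrable_comp hT.continuous hζ n (continuous_weightedSq_fst_sub w z)
    rw [← integral_const_mul, ← integral_sub h1 (h0.const_mul α)]
    refine integral_mono (h1.sub (h0.const_mul α))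
      (hx.integrable_comp hT.continuous hζ n (continuous_lyapunov w _ _ _ z)) fun ω => ?_
    have h2 := mul_le_mul_of_nonneg_right (hpar.le n) (weightedSq_nonneg hw (x n ω - z))
    have h3 := mul_nonneg (hpar.coeff_nonneg n) (weightedSq_nonneg hw (x (n + 1) ω - x n ω))
    simp only [lyapunov]
    linarith
  · have h := hx.setIntegral_lyapunov_succ_le hpar hT hz hζ hind hq hq0 n MeasurableSet.univ
    simpa only [Measure.restrict_univ] using h

/-- Almost surely, the weighted distances to a given fixed point converge. -/
theorem ae_exists_tendsto_weightedSq (hx : IsInertialBlockIteration T ζ a r x)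
    (hpar : InertialParameters a r α ρ θ δ) (hT : LipschitzWith 1 T) (hz : T z = z)
    (hζ : ∀ n, Measurable (ζ n)) (hind : iIndepFun ζ P)
    (hq : ∀ n j, P.real {ω | j ∈ ζ n ω} = q j) (hq0 : ∀ j, 0 < q j) :
    ∀ᵐ ω ∂P, ∃ l, Tendsto (fun n => weightedSq (fun j => (q j)⁻¹) (x n ω - z)) atTop (𝓝 l) := by
  obtain ⟨⟨C, hC⟩, hsum⟩ := hx.integral_bounded hpar hT hz hζ hind hq hq0
  have hmain := fun n A => hx.setIntegral_lyapunov_succ_le (A := A) hpar hT hz hζ hind hq hq0 n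
  set w : Fin J → ℝ := fun j => (q j)⁻¹ with hw_def
  have hw : ∀ j, 0 ≤ w j := fun j => (inv_pos.2 (hq0 j)).le
  have hd (n : ℕ) : Integrable (fun ω => weightedSq w (x (n + 1) ω - x n ω)) P :=
    hx.integrable_comp hT.continuous hζ n (continuous_weightedSq_diff w)
  have hφ (n : ℕ) : Integrable (fun ω => weightedSq w (x n ω - z)) P :=
    hx.integrable_comp hT.continuous hζ n (continuous_weightedSq_fst_sub w z)
  let L : ℕ → Ω → ℝ := fun n ω => lyapunov w (a n) (r n) δ z (x n ω, x (n + 1) ω)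
  have hL (n : ℕ) : Integrable (L n) P :=
    hx.integrable_comp hT.continuous hζ n (continuous_lyapunov w _ _ _ z)
  have hsuper : Supermartingale L (selectionFiltration ζ hζ) P := by
    refine supermartingale_of_setIntegral_succ_le
      (fun n => hx.stronglyMeasurable_comp hT.continuous hζ n (continuous_lyapunov w _ _ _ z)) hL
      fun n A hA => ?_
    have h1 := hmain n A hA
    have h2 : 0 ≤ ∫ ω in A, weightedSq w (x (n + 2) ω - x (n + 1) ω) ∂P :=
      integral_nonneg fun ω => weightedSq_nonneg hw _
    have h3 := mul_nonneg hpar.theta_pos.le h2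
    change ∫ ω in A, lyapunov w (a (n + 1)) (r (n + 1)) δ z (x (n + 1) ω, x (n + 2) ω) ∂P
      ≤ ∫ ω in A, lyapunov w (a n) (r n) δ z (x n ω, x (n + 1) ω) ∂P
    linarith
  obtain ⟨D, hD⟩ := hsum.tendsto_atTop_zero.bddAbove_range
  -- The Lyapunov function may be negative, so martingale convergence is obtained from an L¹ bound.
  have hbound (n : ℕ) : ∫ ω, ‖L n ω‖ ∂P ≤ C + C + (2 + δ) * D := by
    have hpt : ∀ ω, ‖L n ω‖ ≤ weightedSq w (x (n + 1) ω - z) + weightedSq w (x n ω - z)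
        + (2 + δ) * weightedSq w (x (n + 1) ω - x n ω) := by
      intro ω
      have h1 := weightedSq_nonneg hw (x (n + 1) ω - z)
      have h2 := weightedSq_nonneg hw (x n ω - z)
      have h3 := weightedSq_nonneg hw (x (n + 1) ω - x n ω)
      have h4 := mul_nonneg (hpar.nonneg n) h2
      have h5 := mul_le_mul_of_nonneg_right ((hpar.le n).trans hpar.lt_one.le) h2
      have h6 := mul_nonneg (hpar.coeff_nonneg n) h3
      have h7 := mul_le_mul_of_nonneg_right (hpar.coeff_le n) h3
      rw [Real.norm_eq_abs, abs_le]
      simp only [L, lyapunov]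
      constructor <;> linarith
    have hφφ : Integrable (fun ω => weightedSq w (x (n + 1) ω - z) + weightedSq w (x n ω - z)) P :=
      (hφ (n + 1)).add (hφ n)
    refine (integral_mono (hL n).norm (hφφ.add ((hd n).const_mul (2 + δ))) hpt).trans ?_
    simp only [Pi.add_apply]
    rw [integral_add hφφ ((hd n).const_mul _),
      integral_add (hφ (n + 1)) (hφ n), integral_const_mul]
    have h8 : ∫ ω, weightedSq w (x (n + 1) ω - x n ω) ∂P ≤ D := hD ⟨n, rfl⟩
    have h9 := mul_le_mul_of_nonneg_left h8 (show 0 ≤ 2 + δ by linarith [hpar.delta_pos])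
    linarith [hC n, hC (n + 1)]
  have hconv := hsuper.neg.exists_ae_tendsto_of_bdd (R := (C + C + (2 + δ) * D).toNNReal)
    fun n => by
      rw [Pi.neg_apply, eLpNorm_neg, eLpNorm_one_eq_lintegral_enorm,
        ← ofReal_integral_norm_eq_lintegral_enorm (hL n)]
      exact ENNReal.ofReal_le_ofReal (hbound n)
  have hd_zero := ae_tendsto_zero_of_summable_integral hd
    (fun n ω => weightedSq_nonneg hw _) hsum
  have ha_lim : Tendsto a atTop (𝓝 (⨆ n, a n)) :=
    tendsto_atTop_ciSup hpar.mono ⟨α, by rintro _ ⟨n, rfl⟩; exact hpar.le n⟩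
  filter_upwards [hconv, hd_zero] with ω ⟨c, hc⟩ hdω
  have h1 : Tendsto (fun n => (a n * (1 + a n) + a n * (1 - r n) * δ)
      * weightedSq w (x (n + 1) ω - x n ω)) atTop (𝓝 0) := by
    refine squeeze_zero (fun n => mul_nonneg (hpar.coeff_nonneg n) (weightedSq_nonneg hw _))
      (fun n => mul_le_mul_of_nonneg_right (hpar.coeff_le n) (weightedSq_nonneg hw _)) ?_
    simpa using hdω.const_mul (2 + δ)
  have h2 : Tendsto (fun n => weightedSq w (x (n + 1) ω - z) - a n * weightedSq w (x n ω - z))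
      atTop (𝓝 (-c - 0)) := by
    refine (hc.neg.sub h1).congr fun n => ?_
    simp only [Pi.neg_apply, L, lyapunov]
    ring
  exact exists_tendsto_of_tendsto_sub_mul (φ := fun n => weightedSq w (x n ω - z))
    hpar.alpha_nonneg hpar.lt_one (fun n => ⟨hpar.nonneg n, hpar.le n⟩) ha_lim h2

/-- Almost surely, the residuals of the iterates vanish asymptotically. -/
theorem ae_tendsto_residual (hx : IsInertialBlockIteration T ζ a r x)
    (hpar : InertialParameters a r α ρ θ δ) (hT : LipschitzWith 1 T) (hz : T z = z)
    (hζ : ∀ n, Measurable (ζ n)) (hind : iIndepFun ζ P)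
    (hq : ∀ n j, P.real {ω | j ∈ ζ n ω} = q j) (hq0 : ∀ j, 0 < q j) (hq1 : ∀ j, q j ≤ 1) :
    ∀ᵐ ω ∂P, Tendsto (fun n => T (x n ω) - x n ω) atTop (𝓝 0) := by
  classical
  obtain ⟨-, hsum⟩ := hx.integral_bounded hpar hT hz hζ hind hq hq0
  set w : Fin J → ℝ := fun j => (q j)⁻¹ with hw_def
  have hw1 : ∀ j, 1 ≤ w j := fun j => (one_le_inv₀ (hq0 j)).2 (hq1 j)
  have hw : ∀ j, 0 ≤ w j := fun j => zero_le_one.trans (hw1 j)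
  have hd (n : ℕ) : Integrable (fun ω => weightedSq w (x (n + 1) ω - x n ω)) P :=
    hx.integrable_comp hT.continuous hζ n (continuous_weightedSq_diff w)
  let y : ℕ → Ω → PiLp 2 Z := fun n ω => extrapolate (a n) (x n ω) (x (n + 1) ω)
  let h (n : ℕ) (j : Fin J) : PiLp 2 Z × PiLp 2 Z → ℝ := fun p =>
    ‖T (extrapolate (a n) p.1 p.2) j - extrapolate (a n) p.1 p.2 j‖ ^ 2
  have hh (n : ℕ) (j : Fin J) : Continuous (h n j) := by
    have h1 := continuous_extrapolate (Z := Z) (a n)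
    have h2 := hT.continuous.comp h1
    exact (((PiLp.continuous_apply 2 _ j).comp h2).sub
      ((PiLp.continuous_apply 2 _ j).comp h1)).norm.pow 2
  have hsq (n : ℕ) (ω : Ω) :
      ∑ j, h n j (x n ω, x (n + 1) ω) = ‖T (y n ω) - y n ω‖ ^ 2 := by
    rw [PiLp.norm_sq_eq_of_L2]
    rfl
  have hres_int (n : ℕ) : Integrable (fun ω => ‖T (y n ω) - y n ω‖ ^ 2) P := by
    simp only [← hsq]
    exact integrable_finsetSum _ fun j _ => hx.integrable_comp hT.continuous hζ n (hh n j)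
  -- The move from `y n` to `x (n + 2)` is `r n` times the selected residual, with `r n ≥ ρ`, and it
  -- is controlled by two successive increments.
  have hpt (n : ℕ) (ω : Ω) : ∑ j, (w j * h n j (x n ω, x (n + 1) ω))
        * (if j ∈ ζ n ω then 1 else 0 : ℝ)
      ≤ 2 / ρ ^ 2 * (weightedSq w (x (n + 2) ω - x (n + 1) ω)
        + weightedSq w (x (n + 1) ω - x n ω)) := by
    have h1 := weightedSq_relaxed_blockOperator_sub w T (ζ n ω) (y n ω) (r n)
    rw [← hx.step n ω] at h1
    have h2 : x (n + 2) ω - y n ω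
        = (x (n + 2) ω - x (n + 1) ω) - a n • (x (n + 1) ω - x n ω) := by
      simp only [y, extrapolate]
      abel
    have h3 := weightedSq_sub_le hw (x (n + 2) ω - x (n + 1) ω) (a n • (x (n + 1) ω - x n ω))
    rw [← h2, weightedSq_smul, h1] at h3
    have h4 : a n ^ 2 ≤ 1 := pow_le_one₀ (hpar.nonneg n) ((hpar.le n).trans hpar.lt_one.le)
    have h5 := mul_le_mul_of_nonneg_right h4 (weightedSq_nonneg hw (x (n + 1) ω - x n ω))
    have h6 : 0 ≤ ∑ j, (w j * h n j (x n ω, x (n + 1) ω)) * (if j ∈ ζ n ω then 1 else 0 : ℝ) :=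
      Finset.sum_nonneg fun j _ => mul_nonneg (mul_nonneg (hw j) (sq_nonneg _))
        (by split_ifs <;> norm_num)
    have h7 := mul_le_mul_of_nonneg_right (pow_le_pow_left₀ hpar.rho_pos.le (hpar.rho_le n) 2) h6
    have h8 : 0 < ρ ^ 2 := pow_pos hpar.rho_pos 2
    rw [div_mul_eq_mul_div, le_div_iff₀ h8]
    change r n ^ 2 * ∑ j, (w j * h n j (x n ω, x (n + 1) ω)) * (if j ∈ ζ n ω then 1 else 0 : ℝ)
      ≤ _ at h3
    linarith
  have hres_le (n : ℕ) : ∫ ω, ‖T (y n ω) - y n ω‖ ^ 2 ∂P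
      ≤ 2 / ρ ^ 2 * (∫ ω, weightedSq w (x (n + 2) ω - x (n + 1) ω) ∂P
        + ∫ ω, weightedSq w (x (n + 1) ω - x n ω) ∂P) := by
    -- Averaging over the selection recovers the full residual from its selected blocks.
    have h1 := setIntegral_sum_selection hζ hind n (hq n) hq0
      (fun j => hx.stronglyMeasurable_comp hT.continuous hζ n (hh n j))
      (fun j => hx.integrable_comp hT.continuous hζ n (hh n j)) MeasurableSet.univ
    simp only [Measure.restrict_univ, hsq] at h1
    rw [← h1, ← integral_add (hd (n + 1)) (hd n), ← integral_const_mul]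
    refine integral_mono_of_nonneg (ae_of_all _ fun ω => ?_)
      (((hd (n + 1)).add (hd n)).const_mul _) (ae_of_all _ fun ω => hpt n ω)
    exact Finset.sum_nonneg fun j _ => mul_nonneg (mul_nonneg (hw j) (sq_nonneg _))
      (by split_ifs <;> norm_num)
  have hres_sum : Summable fun n => ∫ ω, ‖T (y n ω) - y n ω‖ ^ 2 ∂P :=
    Summable.of_nonneg_of_le (fun n => integral_nonneg fun ω => sq_nonneg _) hres_le
      ((((summable_nat_add_iff 1).2 hsum).add hsum).mul_left _)
  filter_upwards [ae_tendsto_zero_of_summable_integral hd (fun n ω => weightedSq_nonneg hw _) hsum,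
    ae_tendsto_zero_of_summable_integral hres_int (fun n ω => sq_nonneg _) hres_sum]
    with ω hdω hresω
  rw [← tendsto_add_atTop_iff_nat 1]
  -- The residual at `x (n + 1)` exceeds that at `y n` by at most twice their distance, hence the
  -- factor 2.
  have hlim : Tendsto (fun n => Real.sqrt (‖T (y n ω) - y n ω‖ ^ 2)
      + 2 * Real.sqrt (weightedSq w (x (n + 1) ω - x n ω))) atTop (𝓝 0) := by
    simpa using hresω.sqrt.add (hdω.sqrt.const_mul 2)
  refine squeeze_zero_norm (fun n => ?_) hlim
  rw [Real.sqrt_sq (norm_nonneg _)]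
  have h1 : ‖y n ω - x (n + 1) ω‖ ≤ Real.sqrt (weightedSq w (x (n + 1) ω - x n ω)) := by
    have h2 : y n ω - x (n + 1) ω = a n • (x (n + 1) ω - x n ω) := by
      simp only [y, extrapolate]
      abel
    rw [h2, norm_smul, Real.norm_eq_abs, abs_of_nonneg (hpar.nonneg n)]
    exact (mul_le_of_le_one_left (norm_nonneg _) ((hpar.le n).trans hpar.lt_one.le)).trans
      (Real.le_sqrt_of_sq_le (sq_norm_le_weightedSq hw1 _))
  have h2 : ‖T (x (n + 1) ω) - T (y n ω)‖ ≤ ‖y n ω - x (n + 1) ω‖ := by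
    have := hT.dist_le_mul (x (n + 1) ω) (y n ω)
    rwa [NNReal.coe_one, one_mul, dist_comm (x (n + 1) ω), dist_eq_norm, dist_eq_norm] at this
  have h3 : T (x (n + 1) ω) - x (n + 1) ω = (T (x (n + 1) ω) - T (y n ω))
      + (T (y n ω) - y n ω) + (y n ω - x (n + 1) ω) := by abel
  rw [h3]
  refine norm_add₃_le.trans ?_
  linarith

/-- Almost sure convergence of the relaxed inertial block iteration to a fixed point. -/
theorem ae_exists_tendsto_fixedPoint [∀ j, FiniteDimensional ℝ (Z j)]
    (hx : IsInertialBlockIteration T ζ a r x)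
    (hpar : InertialParameters a r α ρ θ δ) (hT : LipschitzWith 1 T)
    (hFix : (Function.fixedPoints T).Nonempty)
    (hζ : ∀ n, Measurable (ζ n)) (hind : iIndepFun ζ P)
    (hq : ∀ n j, P.real {ω | j ∈ ζ n ω} = q j) (hq0 : ∀ j, 0 < q j) :
    ∀ᵐ ω ∂P, ∃ y ∈ Function.fixedPoints T, Tendsto (fun n => x n ω) atTop (𝓝 y) := by
  have hq1 : ∀ j, q j ≤ 1 := fun j => hq 0 j ▸ measureReal_le_one
  have hw1 : ∀ j, 1 ≤ (q j)⁻¹ := fun j => (one_le_inv₀ (hq0 j)).2 (hq1 j)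
  -- The exceptional null set depends on the fixed point, so only countably many fixed points are
  -- used.
  obtain ⟨D, hDF, hD_count, hD_dense⟩ :=
    (TopologicalSpace.IsSeparable.of_separableSpace
      (Function.fixedPoints T)).exists_countable_dense_subset
  have hD_ne : D.Nonempty := closure_nonempty_iff.1 (hFix.mono hD_dense)
  obtain ⟨z₀, hz₀⟩ := hFix
  have hlim : ∀ᵐ ω ∂P, ∀ z ∈ D, ∃ l,
      Tendsto (fun n => weightedSq (fun j => (q j)⁻¹) (x n ω - z)) atTop (𝓝 l) :=
    (ae_ball_iff hD_count).2 fun z hz =>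
      hx.ae_exists_tendsto_weightedSq hpar hT (hDF hz) hζ hind hq hq0
  filter_upwards [hlim, hx.ae_tendsto_residual hpar hT hz₀ hζ hind hq hq0 hq1] with ω h1 h2
  exact tendsto_fixedPoint_of_weightedSq hw1 hT.continuous hD_ne hD_dense h1 h2

end IsInertialBlockIteration

end Convergence

theorem theorem5p1 {J : ℕ} {Z : Fin J → Type*} [∀ j, NormedAddCommGroup (Z j)]
    [∀ j, InnerProductSpace ℝ (Z j)] [∀ j, FiniteDimensional ℝ (Z j)]
    (T : PiLp 2 Z → PiLp 2 Z) (hT : LipschitzWith 1 T) (hFix : (Function.fixedPoints T).Nonempty)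
    {Ω : Type*} [MeasurableSpace Ω] (P : MeasureTheory.Measure Ω)
    [MeasureTheory.IsProbabilityMeasure P]
    (ζ : ℕ+ → Ω → Set (Fin J)) (hζ_meas : ∀ k, Measurable (ζ k))
    (hζ_indep : ProbabilityTheory.iIndepFun ζ P)
    (hζ_ident : ∀ k, ProbabilityTheory.IdentDistrib (ζ k) (ζ 1) P P)
    (hζ_pos : ∀ j : Fin J, ∃ ϑ : Set (Fin J), j ∈ ϑ ∧ 0 < P {ω | ζ 1 ω = ϑ})
    (a r : ℕ → ℝ) (α ρ θ δ : ℝ)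
    (ha_mono : MonotoneOn a (Set.Ici 1)) (ha_one : a 1 = 0)
    (ha_bound : ∀ k, 1 ≤ k → 0 ≤ a k ∧ a k ≤ α) (hα : α < 1)
    (hρ : 0 < ρ) (hθ : 0 < θ) (hδ : 0 < δ)
    (hδ_bound : δ > (α ^ 2 * (1 + α) + α * θ) / (1 - α ^ 2))
    (hr_bound : ∀ k, 1 ≤ k → ρ ≤ r k ∧
      r k < (δ - α * (α * (1 + α) + α * δ + θ)) / (δ * (1 + α * (1 + α) + α * δ + θ)))
    (x₀ x₁ : PiLp 2 Z) (x : ℕ → Ω → PiLp 2 Z)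
    (hx_zero : ∀ ω, x 0 ω = x₀) (hx_one : ∀ ω, x 1 ω = x₁)
    (hx_step : ∀ k, 1 ≤ k → ∀ ω,
      x (k + 1) ω = x k ω + a k • (x k ω - x (k - 1) ω)
        + r k • (blockOperator T (ζ k.succPNat ω) (x k ω + a k • (x k ω - x (k - 1) ω))
          - x k ω - a k • (x k ω - x (k - 1) ω))) :
    ∀ᵐ ω ∂P, ∃ y ∈ Function.fixedPoints T,
      Filter.Tendsto (fun k => x k ω) Filter.atTop (nhds y) := by
  -- Index `n` stands for step `k = n + 1`, whose selection is `ζ` at `k + 1 = n + 2`.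
  have hx : IsInertialBlockIteration T (fun n => ζ (n + 1).succPNat) (fun n => a (n + 1))
      (fun n => r (n + 1)) x :=
    ⟨⟨x₀, hx_zero⟩, ⟨x₁, hx_one⟩, fun n ω => by
      have h := hx_step (n + 1) (by omega) ω
      rw [sub_sub] at h
      exact h⟩
  have hpar : InertialParameters (fun n => a (n + 1)) (fun n => r (n + 1)) α ρ θ δ :=
    { mono := fun m n hmn => ha_mono (by simp) (by simp) (by omega)
      nonneg := fun n => (ha_bound _ (by omega)).1
      le := fun n => (ha_bound _ (by omega)).2
      lt_one := hα
      rho_pos := hρ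
      theta_pos := hθ
      delta_pos := hδ
      rho_le := fun n => (hr_bound _ (by omega)).1
      r_lt := fun n => (hr_bound _ (by omega)).2 }
  have hinj : Function.Injective fun n : ℕ => (n + 1).succPNat := fun m n h => by
    have := Nat.succPNat_injective h
    omega
  refine hx.ae_exists_tendsto_fixedPoint (q := fun j => P.real {ω | j ∈ ζ 1 ω}) hpar hT hFix
    (fun n => hζ_meas _) (hζ_indep.precomp hinj) (fun n j => ?_) (fun j => ?_)
  · exact congrArg ENNReal.toReal ((hζ_ident _).measure_mem_eq
      (measurableSet_setOfPred.2 (measurable_set_mem j)))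
  · obtain ⟨ϑ, hj, hpos⟩ := hζ_pos j
    refine ENNReal.toReal_pos (hpos.trans_le (measure_mono ?_)).ne' (measure_ne_top _ _)
    rintro ω rfl
    exact hj
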